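/- **Setting.** For a sorted array $A$ of $n$ keys $a_1\le\dots\le a_n$ in $[0,1]$, the rank of $q\in\mathbb R$ is $r_A(q)=\#\{i: a_i\le q\}$; put $a_0=0$ and $a_{i}=1$ for $i>n$. A *piecewise constant model* divides the interval between two keys $a_{l}$ and $a_{h}$ uniformly into $t\ge 1$ pieces and takes a constant value on each piece (queries outside of the interval use the first or the last piece). A *recursive model index* (RMI) is a finite tree with a piecewise constant model in each node: the model of an inner node selects the child at which the query continues; the model of a leaf predicts a position $p$ in the array, and a binary search of $A$ over the window $[p-e,p+e]\cap[0,n]$, where $e$ is an integer stored in the leaf, returns the answer. Its *depth* is its number of levels. Its *query time* on a query $q$ is the number of operations performed (a fixed number for each node visited and for each round of the binary search, where each elementary arithmetic operation, comparison, and access to the array or to the index counts once). Its *space overhead* is the number of bits needed to store the tree: the integers that describe the nodes, the tables of model values (a table of $t$ integers that are at most $M$ takes $t$ times the binary length of $M$) and the pointers to the children; the array itself is not counted. **Theorem.** There is an absolute constant $C>0$ such that the following holds for all reals $0<\rho_1\le\rho_2<\infty$ and all integers $n\ge 3$. There is a procedure that builds from every sorted array $A\in[0,1]^n$ an RMI $\hat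 R_A$ with piecewise constant models such that 1. for every sorted array $A\in[0,1]^n$: $\hat R_A$ answers every query $q\in\mathbb R$ correctly, i.e. $\hat R_A(q)=r_A(q)$; its depth is at most $C\log\log n$; and its space overhead is at most $C\,\frac{\rho_2}{\rho_1}\,n\log n$ bits; 2. for every probability distribution $\chi$ on $[0,1]$ with a density $f$ such that $\rho_1\le f(x)\le\rho_2$ for all $x\in[0,1]$, and for every query $q\in\mathbb R$: if $A$ is the array obtained by sorting $n$ independent samples from $\chi$, then the expected query time of $\hat R_A$ on $q$ is at most $C\log\log n$. -/

import Mathlib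

open MeasureTheory

namespace LearnedIndex

noncomputable section

/-! ### Sorted arrays and the rank problem -/

/-- The rank function of an array: the number of keys that are at most `q`. -/
def rank {n : ℕ} (A : Fin n → ℝ) (q : ℝ) : ℕ :=
  (Finset.univ.filter fun i => A i ≤ q).card

/-- The samples rearranged in ascending order. -/
def sortedArray {n : ℕ} (X : Fin n → ℝ) : Fin n → ℝ :=
  X ∘ Tuple.sort X

/-- The keys `a₁ ≤ … ≤ aₙ` of an array, with 1-based positions, extended by the end points of
the key domain `[0, 1]`: position `0` holds `0` and every position beyond `n` holds `1`. -/
def key {n : ℕ} (A : Fin n → ℝ) (i : ℕ) : ℝ :=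
  if h : 1 ≤ i ∧ i ≤ n then A ⟨i - 1, by omega⟩ else if i = 0 then 0 else 1

/-! ### Error correction: binary search, with its number of operations -/

/-- Operations of one round of binary search: loop test, midpoint (addition, halving, increment),
read of a key, comparison with the query. -/
def roundOps : ℕ := 6

/-- Binary search for the rank of `q` among the candidates `lo, lo + 1, …, hi`. The first component
is the answer, the second one the number of operations performed. -/
def binSearch {n : ℕ} (A : Fin n → ℝ) (q : ℝ) (lo hi : ℕ) : ℕ × ℕ :=
  if _h : lo < hi then
    if key A ((lo + hi) / 2 + 1) ≤ q then
      let r := binSearch A q ((lo + hi) / 2 + 1) hi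
      (r.1, roundOps + r.2)
    else
      let r := binSearch A q lo ((lo + hi) / 2)
      (r.1, roundOps + r.2)
  else (lo, 1)
termination_by hi - lo
decreasing_by all_goals omega

/-! ### Piecewise constant models -/

/-- A piecewise constant model with values in `α`: the interval between the keys at positions `lo`
and `hi` is divided uniformly into `pieces` pieces, and on the `z`-th piece the model has the
value `val z`. -/
structure PCModel (α : Type) where
  lo : ℕ
  hi : ℕ
  pieces : ℕ
  pieces_pos : 0 < pieces
  val : Fin pieces → α

/-- The piece that is responsible for `q` (the first or the last one, if `q` lies to the left or
to the right of the interval). -/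
def PCModel.piece {α : Type} (m : PCModel α) {n : ℕ} (A : Fin n → ℝ) (q : ℝ) : Fin m.pieces :=
  ⟨min (m.pieces - 1)
      ⌊(q - key A m.lo) / (key A m.hi - key A m.lo) * (m.pieces : ℝ)⌋₊, by
    have := m.pieces_pos
    omega⟩

/-- The value that the model predicts for `q`. -/
def PCModel.eval {α : Type} (m : PCModel α) {n : ℕ} (A : Fin n → ℝ) (q : ℝ) : α :=
  m.val (m.piece A q)

/-- Operations of one evaluation of a piecewise constant model: reads of `lo`, `hi`, `pieces` (3),
reads of two keys (2), two subtractions, a division, a multiplication and a rounding (5), two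
comparisons for queries outside of the interval (2), one read of the table of values (1). -/
def evalOps : ℕ := 13

/-- Length of a self-delimiting binary code of the integer `m`. -/
def codeLen (m : ℕ) : ℕ := 2 * Nat.size (m + 1)

/-- Number of bits of each entry of the table of values, when the value `v` is stored as the
integer `code v`: the length of the binary representation of the largest entry. -/
def PCModel.width {α : Type} (m : PCModel α) (code : α → ℕ) : ℕ :=
  max 1 (Nat.size (Finset.univ.sup fun z => code (m.val z)))

/-- Number of bits needed to store the model. -/
def PCModel.bits {α : Type} (m : PCModel α) (code : α → ℕ) : ℕ :=
  codeLen m.lo + codeLen m.hi + codeLen m.pieces + codeLen (m.width code)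
    + m.pieces * m.width code

/-! ### Recursive model indexes with piecewise constant models -/

/-- A recursive model index. The model of an inner node selects one of the `k` children of the
node; the model of a leaf predicts the position of the query in the array, and `err` is the radius
of the window around the prediction that is searched by the error correction. -/
inductive RMI : Type
  | leaf (model : PCModel ℕ) (err : ℕ) : RMI
  | node (k : ℕ) (model : PCModel (Fin k)) (child : Fin k → RMI) : RMI

namespace RMI

/-- Answers the query `q` on the array `A`. The first component is the answer, the second one the
number of operations performed. At an inner node the model is evaluated and the pointer to the
selected child is read; at a leaf the model is evaluated, `err` is read, the two ends of the window
`[p - err, p + err] ∩ [0, n]` around the prediction `p` are computed (3 operations) and the window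
is searched. -/
def query {n : ℕ} (A : Fin n → ℝ) (q : ℝ) : RMI → ℕ × ℕ
  | leaf model err =>
      let p := model.eval A q
      let r := binSearch A q (p - err) (min n (p + err))
      (r.1, evalOps + 1 + 3 + r.2)
  | node _ model child =>
      let r := query A q (child (model.eval A q))
      (r.1, evalOps + 1 + r.2)

/-- The answer of the index to the query `q`. -/
def answer {n : ℕ} (I : RMI) (A : Fin n → ℝ) (q : ℝ) : ℕ := (I.query A q).1

/-- The number of operations that the index performs to answer the query `q`. -/
def ops {n : ℕ} (I : RMI) (A : Fin n → ℝ) (q : ℝ) : ℕ := (I.query A q).2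

/-- The number of levels of the hierarchy. -/
def depth : RMI → ℕ
  | leaf _ _ => 1
  | node _ _ child => 1 + Finset.univ.sup fun c => depth (child c)

/-- The space overhead in bits. A node is stored as a tag, its integers and its model, followed,
for an inner node, by `k` pointers to its children and by the consecutive records of the children;
a pointer is an offset into the part of the memory that holds the children, and all of them are
stored with the same number of bits. -/
def bits : RMI → ℕ
  | leaf model err => 1 + model.bits id + codeLen err
  | node k model child =>
      1 + model.bits (fun c => (c : ℕ)) + codeLen k
        + codeLen (Nat.size (∑ c, bits (child c)))
        + k * Nat.size (∑ c, bits (child c))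
        + ∑ c, bits (child c)

end RMI

end

end LearnedIndex

/-! A single leaf suffices. Divide `[0, 1]` into `t = ⌈(ρ₂/ρ₁) n⌉` pieces and predict, for `q`, the
number of keys in pieces to the left of its own. Pieces are ordered like the keys, so the rank
exceeds this prediction by at most the load of that piece; the largest load `e` is a safe radius for
every array, and the binary search costs `O(log (e + 1))`.

For random keys a piece has mass at most `ρ₂/t ≤ ρ₁/n ≤ 1/n`, because a density that is at least
`ρ₁` on `[0, 1]` forces `ρ₁ ≤ 1`. A piece of mass `p` has load `l` with `E 2^l = (1 + p)^n ≤ 1 +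
2np`. Summing over the pieces, whose masses add up to at most 1, gives `E 2^e ≤ 1 + 2n`
(`integral_two_pow_maxLoad_le`). The pointwise bound `log_add_one_le`, linear in `2^e / n`, turns
this into `E log (e + 1) ≤ log log n + O(1)`. -/

namespace LearnedIndex

/-! ### Correctness and cost of binary search -/

section BinarySearch

variable {n : ℕ}

lemma rank_le (A : Fin n → ℝ) (q : ℝ) : rank A q ≤ n := by
  simpa [rank] using Finset.card_le_univ (Finset.univ.filter fun i => A i ≤ q)

lemma key_of_mem (A : Fin n → ℝ) {j : ℕ} (h1 : 1 ≤ j) (hn : j ≤ n) :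
    key A j = A ⟨j - 1, by omega⟩ := by
  simp [key, h1, hn]

lemma card_filter_fin_val_lt {j : ℕ} (hj : j ≤ n) :
    (Finset.univ.filter fun i : Fin n => (i : ℕ) < j).card = j := by
  rw [Fin.card_filter_val_lt, min_eq_right hj]

lemma key_le_iff_le_rank {A : Fin n → ℝ} (hA : Monotone A) (q : ℝ) {j : ℕ} (h1 : 1 ≤ j)
    (hn : j ≤ n) : key A j ≤ q ↔ j ≤ rank A q := by
  rw [key_of_mem A h1 hn]
  constructor
  · intro h
    rw [← card_filter_fin_val_lt hn]
    refine Finset.card_le_card fun i hi => ?_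
    simp only [Finset.mem_filter, Finset.mem_univ, true_and] at hi ⊢
    exact (hA (Fin.le_def.2 (by simp only; omega))).trans h
  · intro h
    by_contra! hq
    have : rank A q ≤ j - 1 := by
      rw [← card_filter_fin_val_lt (show j - 1 ≤ n by omega)]
      refine Finset.card_le_card fun i hi => ?_
      simp only [Finset.mem_filter, Finset.mem_univ, true_and] at hi ⊢
      by_contra! hij
      exact absurd ((hA (show (⟨j - 1, by omega⟩ : Fin n) ≤ i from hij)).trans hi) (not_le.2 hq)
    omega

lemma binSearch_fst {A : Fin n → ℝ} (hA : Monotone A) (q : ℝ) (lo hi : ℕ)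
    (h₁ : lo ≤ rank A q) (h₂ : rank A q ≤ hi) (hn : hi ≤ n) :
    (binSearch A q lo hi).1 = rank A q := by
  induction lo, hi using binSearch.induct A q with
  | case1 lo hi h hk ih =>
    rw [binSearch, dif_pos h, if_pos hk]
    exact ih ((key_le_iff_le_rank hA q (by omega) (by omega)).1 hk) h₂ hn
  | case2 lo hi h hk ih =>
    rw [binSearch, dif_pos h, if_neg hk]
    rw [key_le_iff_le_rank hA q (by omega) (by omega)] at hk
    exact ih h₁ (by omega) (by omega)
  | case3 lo hi h =>
    rw [binSearch, dif_neg h]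
    simp only
    omega

lemma binSearch_snd_le (A : Fin n → ℝ) (q : ℝ) (k lo hi : ℕ) (h : hi - lo < 2 ^ k) :
    (binSearch A q lo hi).2 ≤ 1 + roundOps * k := by
  induction k generalizing lo hi with
  | zero =>
    rw [binSearch, dif_neg (by simp at h; omega)]
    simp
  | succ k ih =>
    rw [pow_succ] at h
    rw [binSearch]
    split_ifs with h₁ h₂
    · have := ih ((lo + hi) / 2 + 1) hi (by omega)
      simp only [roundOps] at this ⊢
      omega
    · have := ih lo ((lo + hi) / 2) (by omega)
      simp only [roundOps] at this ⊢
      omega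
    · simp

/-- A run sees the keys only through the outcomes of its comparisons. This later reduces
measurability of the operation count to that of a few integers. -/
lemma binSearch_congr {A B : Fin n → ℝ} {q q' : ℝ} (lo hi : ℕ) (hn : hi ≤ n)
    (h : ∀ j, 1 ≤ j → j ≤ n → (key A j ≤ q ↔ key B j ≤ q')) :
    binSearch A q lo hi = binSearch B q' lo hi := by
  induction lo, hi using binSearch.induct A q with
  | case1 lo hi hl hk ih =>
    rw [binSearch, dif_pos hl, if_pos hk, ih hn, binSearch.eq_def B q' lo hi, dif_pos hl,
      if_pos ((h _ (by omega) (by omega)).1 hk)]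
  | case2 lo hi hl hk ih =>
    rw [binSearch, dif_pos hl, if_neg hk, ih (by omega), binSearch.eq_def B q' lo hi, dif_pos hl,
      if_neg (fun hB => hk ((h _ (by omega) (by omega)).2 hB))]
  | case3 lo hi hl =>
    rw [binSearch, dif_neg hl, binSearch, dif_neg hl]

/-- A sorted array in which the query `0` has rank `r`. -/
noncomputable def stepArray (n r : ℕ) : Fin n → ℝ := fun i => if (i : ℕ) < r then 0 else 1

/-- On a sorted array, the run of a binary search is determined by the rank of the query. -/
lemma binSearch_eq_stepArray {A : Fin n → ℝ} (hA : Monotone A) (q : ℝ) (lo hi : ℕ)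
    (hn : hi ≤ n) :
    binSearch A q lo hi = binSearch (stepArray n (rank A q)) 0 lo hi := by
  refine binSearch_congr lo hi hn fun j h1 hj => ?_
  rw [key_le_iff_le_rank hA q h1 hj, key_of_mem _ h1 hj, stepArray]
  split_ifs with h
  · simp only at h
    simp only [le_refl, iff_true]; omega
  · simp only at h
    have : ¬ (1 : ℝ) ≤ 0 := by norm_num
    simp only [this, iff_false]; omega

end BinarySearch

/-! ### The one-leaf index: correctness, worst-case cost, space -/

section Index

variable {n : ℕ}

/-- The number of the piece of `[0, 1]`, divided uniformly into `t` pieces, that is responsible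
for `x`. -/
noncomputable def bin (t : ℕ) (x : ℝ) : ℕ := min (t - 1) ⌊x * (t : ℝ)⌋₊

/-- The number of keys in the pieces to the left of the `z`-th one. -/
noncomputable def below (t : ℕ) (A : Fin n → ℝ) (z : ℕ) : ℕ :=
  (Finset.univ.filter fun i => bin t (A i) < z).card

/-- The number of keys in the `z`-th piece. -/
noncomputable def load (t : ℕ) (A : Fin n → ℝ) (z : ℕ) : ℕ :=
  (Finset.univ.filter fun i => bin t (A i) = z).card

/-- The largest number of keys in a piece. -/
noncomputable def maxLoad (t : ℕ) (A : Fin n → ℝ) : ℕ := (Finset.range t).sup (load t A)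

/-- The index with a single model, which divides `[0, 1]` into `t` pieces. It predicts the number
of keys to the left of the piece of the query. -/
noncomputable def pieceIndex (t : ℕ) (ht : 0 < t) (A : Fin n → ℝ) : RMI :=
  .leaf ⟨0, n + 1, t, ht, fun z => below t A z⟩ (maxLoad t A)

lemma bin_lt {t : ℕ} (ht : 0 < t) (x : ℝ) : bin t x < t := by
  unfold bin; omega

lemma bin_mono (t : ℕ) : Monotone (bin t) := fun x y h => by
  unfold bin
  exact min_le_min_left _ (Nat.floor_mono (by gcongr))

lemma measurable_bin (t : ℕ) : Measurable (bin t) := (bin_mono t).measurable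

lemma below_le_rank (t : ℕ) (A : Fin n → ℝ) (q : ℝ) : below t A (bin t q) ≤ rank A q := by
  refine Finset.card_le_card fun i hi => ?_
  simp only [Finset.mem_filter, Finset.mem_univ, true_and] at hi ⊢
  by_contra! h
  exact absurd (bin_mono t h.le) (not_le.2 hi)

lemma rank_le_below_add_load (t : ℕ) (A : Fin n → ℝ) (q : ℝ) :
    rank A q ≤ below t A (bin t q) + load t A (bin t q) := by
  refine le_trans (Finset.card_le_card fun i hi => ?_) (Finset.card_union_le _ _)
  simp only [Finset.mem_filter, Finset.mem_univ, true_and, Finset.mem_union] at hi ⊢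
  exact lt_or_eq_of_le (bin_mono t hi)

lemma load_le_maxLoad {t : ℕ} (ht : 0 < t) (A : Fin n → ℝ) (q : ℝ) :
    load t A (bin t q) ≤ maxLoad t A :=
  Finset.le_sup (f := load t A) (Finset.mem_range.2 (bin_lt ht q))

lemma below_le (t : ℕ) (A : Fin n → ℝ) (z : ℕ) : below t A z ≤ n := by
  simpa [below] using Finset.card_le_univ (Finset.univ.filter fun i => bin t (A i) < z)

lemma load_le (t : ℕ) (A : Fin n → ℝ) (z : ℕ) : load t A z ≤ n := by
  simpa [load] using Finset.card_le_univ (Finset.univ.filter fun i => bin t (A i) = z)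

lemma maxLoad_le (t : ℕ) (A : Fin n → ℝ) : maxLoad t A ≤ n :=
  Finset.sup_le fun z _ => load_le t A z

lemma pieceIndex_query {t : ℕ} (ht : 0 < t) (A : Fin n → ℝ) (q : ℝ) :
    (pieceIndex t ht A).query A q =
      ((binSearch A q (below t A (bin t q) - maxLoad t A)
        (min n (below t A (bin t q) + maxLoad t A))).1,
      17 + (binSearch A q (below t A (bin t q) - maxLoad t A)
        (min n (below t A (bin t q) + maxLoad t A))).2) := by
  have h : (PCModel.eval ⟨0, n + 1, t, ht, fun z => below t A z⟩ A q : ℕ)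
      = below t A (bin t q) := by
    -- Positions `0` and `n + 1` hold the sentinel keys 0 and 1, so the model divides exactly `[0,
    -- 1]`.
    simp [PCModel.eval, PCModel.piece, key, bin]
  simp only [pieceIndex, RMI.query, h, evalOps]

lemma pieceIndex_answer {t : ℕ} (ht : 0 < t) {A : Fin n → ℝ} (hA : Monotone A) (q : ℝ) :
    (pieceIndex t ht A).answer A q = rank A q := by
  have h₁ := below_le_rank t A q
  have h₂ := rank_le_below_add_load t A q
  have h₃ := load_le_maxLoad ht A q
  have h₄ := rank_le A q
  rw [RMI.answer, pieceIndex_query]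
  exact binSearch_fst hA q _ _ (by omega) (by omega) (by omega)

lemma pieceIndex_ops_le {t : ℕ} (ht : 0 < t) (A : Fin n → ℝ) (q : ℝ) :
    ((pieceIndex t ht A).ops A q : ℝ) ≤ 30 + 9 * Real.log (maxLoad t A + 1) := by
  set e := maxLoad t A with he
  -- The window has length at most `2e`, and `e + 1 < 2 ^ (log₂ (e + 1) + 1)`; the second extra
  -- power of two covers the doubling. The 30 below is 17 + 1 + 6 · 2.
  have hk : min n (below t A (bin t q) + e) - (below t A (bin t q) - e)
      < 2 ^ (Nat.log 2 (e + 1) + 2) := by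
    have := Nat.lt_pow_succ_log_self (b := 2) (by norm_num) (e + 1)
    rw [Nat.succ_eq_add_one] at this
    rw [show Nat.log 2 (e + 1) + 2 = Nat.log 2 (e + 1) + 1 + 1 by ring, pow_succ]
    omega
  have h₁ := binSearch_snd_le A q _ _ _ hk
  have h₂ : (pieceIndex t ht A).ops A q ≤ 30 + 6 * Nat.log 2 (e + 1) := by
    rw [RMI.ops, pieceIndex_query, ← he]
    simp only [roundOps] at h₁ ⊢
    omega
  have h₃ : (Nat.log 2 (e + 1) : ℝ) ≤ Real.log (e + 1) / Real.log 2 := by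
    have := Real.natLog_le_logb (e + 1) 2
    simpa [Real.logb] using this
  have h₄ : 0 ≤ Real.log ((e : ℝ) + 1) := Real.log_nonneg (by simp)
  have h₅ := Real.log_two_gt_d9
  have h₆ : Real.log ((e : ℝ) + 1) / Real.log 2 ≤ Real.log (e + 1) * (3 / 2) := by
    rw [div_le_iff₀ (by linarith)]
    nlinarith
  have h₇ : ((pieceIndex t ht A).ops A q : ℝ) ≤ 30 + 6 * Nat.log 2 (e + 1) := by
    exact_mod_cast h₂
  linarith

lemma pieceIndex_depth {t : ℕ} (ht : 0 < t) (A : Fin n → ℝ) : (pieceIndex t ht A).depth = 1 := by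
  simp [pieceIndex, RMI.depth]

lemma size_le_self (m : ℕ) : Nat.size m ≤ m := Nat.size_le.2 Nat.lt_two_pow_self

/-- A linear bound is enough: the header integers then cost `O(t)` bits, within the budget set by
the table. -/
lemma codeLen_le (m : ℕ) : codeLen m ≤ 2 * (m + 1) := by
  have := size_le_self (m + 1)
  unfold codeLen; omega

lemma pieceIndex_bits_le {t : ℕ} (ht : 0 < t) (hn : 1 ≤ n) (hnt : n ≤ t) (A : Fin n → ℝ) :
    (pieceIndex t ht A).bits ≤ 25 * t + t * Nat.size n := by
  set m : PCModel ℕ := ⟨0, n + 1, t, ht, fun z => below t A z⟩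
  have hw : m.width id ≤ Nat.size n := by
    refine max_le (Nat.size_pos.2 hn) (Nat.size_le_size ?_)
    exact Finset.sup_le fun z _ => below_le t A z
  have hs := size_le_self n
  have h₀ := codeLen_le 0
  have h₁ := codeLen_le (n + 1)
  have h₂ := codeLen_le t
  have h₃ := codeLen_le (m.width id)
  have h₄ := codeLen_le (maxLoad t A)
  have h₅ := maxLoad_le t A
  have h₆ : t * m.width id ≤ t * Nat.size n := Nat.mul_le_mul_left _ hw
  have h₇ : (pieceIndex t ht A).bits = 1 + (codeLen 0 + codeLen (n + 1) + codeLen t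
      + codeLen (m.width id) + t * m.width id) + codeLen (maxLoad t A) := rfl
  omega

lemma one_le_log_of_three_le {n : ℕ} (hn : 3 ≤ n) : 1 ≤ Real.log n := by
  rw [Real.le_log_iff_exp_le (by positivity)]
  have : (3 : ℝ) ≤ n := by exact_mod_cast hn
  linarith [Real.exp_one_lt_three]

lemma size_le_three_mul_log {n : ℕ} (hn : 3 ≤ n) : (Nat.size n : ℝ) ≤ 3 * Real.log n := by
  have hL := one_le_log_of_three_le hn
  have h₁ : Nat.size n ≤ Nat.log 2 n + 1 := Nat.size_le.2 (Nat.lt_pow_succ_log_self (by norm_num) n)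
  have h₂ : (Nat.log 2 n : ℝ) ≤ Real.log n / Real.log 2 := by
    have := Real.natLog_le_logb n 2
    simpa [Real.logb] using this
  have h₅ := Real.log_two_gt_d9
  have h₆ : Real.log n / Real.log 2 ≤ Real.log n * (3 / 2) := by
    rw [div_le_iff₀ (by linarith)]
    nlinarith
  have h₇ : (Nat.size n : ℝ) ≤ Nat.log 2 n + 1 := by exact_mod_cast h₁
  linarith

end Index

/-! ### Passing from the sorted array to the samples; measurability -/

section Sorting

variable {n : ℕ}

lemma sortedArray_monotone (X : Fin n → ℝ) : Monotone (sortedArray X) := Tuple.monotone_sort X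

lemma card_filter_sortedArray (X : Fin n → ℝ) (p : ℝ → Prop) [DecidablePred p] :
    (Finset.univ.filter fun i => p (sortedArray X i)).card
      = (Finset.univ.filter fun i => p (X i)).card := by
  refine Finset.card_equiv (Tuple.sort X) fun i => ?_
  rw [Finset.mem_filter, Finset.mem_filter]
  simp [sortedArray]

lemma rank_sortedArray (X : Fin n → ℝ) (q : ℝ) : rank (sortedArray X) q = rank X q :=
  card_filter_sortedArray X (· ≤ q)

lemma below_sortedArray (t : ℕ) (X : Fin n → ℝ) (z : ℕ) :
    below t (sortedArray X) z = below t X z :=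
  card_filter_sortedArray X (bin t · < z)

lemma load_sortedArray (t : ℕ) (X : Fin n → ℝ) : load t (sortedArray X) = load t X :=
  funext fun z => card_filter_sortedArray X (bin t · = z)

lemma maxLoad_sortedArray (t : ℕ) (X : Fin n → ℝ) : maxLoad t (sortedArray X) = maxLoad t X := by
  rw [maxLoad, load_sortedArray, maxLoad]

lemma measurable_card_filter {p : ℝ → Prop} [DecidablePred p] (hp : MeasurableSet {x | p x}) :
    Measurable fun X : Fin n → ℝ => (Finset.univ.filter fun i => p (X i)).card := by
  simp only [Finset.card_filter]
  exact Finset.measurable_sum _ fun i _ =>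
    Measurable.ite (measurable_pi_apply i hp) measurable_const measurable_const

lemma measurable_rank (q : ℝ) : Measurable fun X : Fin n → ℝ => rank X q :=
  measurable_card_filter measurableSet_Iic

lemma measurable_below (t z : ℕ) : Measurable fun X : Fin n → ℝ => below t X z :=
  measurable_card_filter (p := fun x => bin t x < z) (measurable_bin t measurableSet_Iio)

lemma measurable_load (t z : ℕ) : Measurable fun X : Fin n → ℝ => load t X z :=
  measurable_card_filter (p := fun x => bin t x = z) (measurable_bin t (measurableSet_singleton z))

lemma measurable_maxLoad (t : ℕ) : Measurable fun X : Fin n → ℝ => maxLoad t X := by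
  have h : Measurable fun X : Fin n → ℝ => fun z : Fin t => load t X z :=
    measurable_pi_lambda _ fun z => measurable_load t z
  have h' : (fun X : Fin n → ℝ => maxLoad t X)
      = (fun l : Fin t → ℕ => Finset.univ.sup l) ∘ fun X => fun z : Fin t => load t X z := by
    funext X
    refine le_antisymm (Finset.sup_le fun z hz => ?_) (Finset.sup_le fun z _ => ?_)
    · exact Finset.le_sup (f := fun z : Fin t => load t X z)
        (Finset.mem_univ ⟨z, Finset.mem_range.1 hz⟩)
    · exact Finset.le_sup (f := load t X) (Finset.mem_range.2 z.2)
  rw [h']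
  exact (measurable_of_countable _).comp h

/-- The operation count factors through three natural numbers that are measurable in the sample, and
every function on a countable discrete space is measurable. -/
lemma measurable_pieceIndex_ops {t : ℕ} (ht : 0 < t) (q : ℝ) :
    Measurable fun X : Fin n → ℝ =>
      (pieceIndex t ht (sortedArray X)).ops (sortedArray X) q := by
  have h : (fun X : Fin n → ℝ => (pieceIndex t ht (sortedArray X)).ops (sortedArray X) q)
      = (fun v : ℕ × ℕ × ℕ =>
          17 + (binSearch (stepArray n v.1) 0 (v.2.1 - v.2.2) (min n (v.2.1 + v.2.2))).2) ∘
        fun X => (rank X q, below t X (bin t q), maxLoad t X) := by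
    funext X
    rw [RMI.ops, pieceIndex_query, binSearch_eq_stepArray (sortedArray_monotone X) q _ _
      (min_le_left _ _), rank_sortedArray, below_sortedArray, maxLoad_sortedArray]
    rfl
  rw [h]
  exact (measurable_of_countable _).comp
    ((measurable_rank q).prodMk ((measurable_below t _).prodMk (measurable_maxLoad t)))

end Sorting

/-! ### Exponential moment of the largest load and expected query time -/

section Expectation

variable {n : ℕ}

/-- Product form over the samples, so that independence makes the expectation an `n`-th power. -/
lemma two_pow_load (t z : ℕ) (X : Fin n → ℝ) :
    (2 : ℝ) ^ load t X z = ∏ i, (1 + (bin t ⁻¹' {z}).indicator 1 (X i)) := by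
  have h : ∀ i, (1 : ℝ) + (bin t ⁻¹' {z}).indicator 1 (X i)
      = if bin t (X i) = z then 2 else 1 := fun i => by
    by_cases hz : bin t (X i) = z
    · simp [hz]; norm_num
    · simp [hz]
  simp only [h, Finset.prod_ite, Finset.prod_const, one_pow, mul_one, load]

lemma integral_two_pow_load (χ : Measure ℝ) [IsProbabilityMeasure χ] (t z : ℕ) :
    ∫ X : Fin n → ℝ, (2 : ℝ) ^ load t X z ∂(Measure.pi fun _ => χ)
      = (1 + χ.real (bin t ⁻¹' {z})) ^ n := by
  have hs : MeasurableSet (bin t ⁻¹' {z}) := measurable_bin t (measurableSet_singleton z)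
  have hi : Integrable ((bin t ⁻¹' {z}).indicator (1 : ℝ → ℝ)) χ :=
    (integrable_const (1 : ℝ)).indicator hs
  simp only [two_pow_load]
  rw [integral_fintype_prod_eq_pow (ι := Fin n)
    (fun x => (1 : ℝ) + (bin t ⁻¹' {z}).indicator 1 x), Fintype.card_fin,
    integral_add (integrable_const _) hi,
    integral_indicator_one hs]
  simp

lemma integrable_two_pow_load (χ : Measure ℝ) [IsProbabilityMeasure χ] (t z : ℕ) :
    Integrable (fun X : Fin n → ℝ => (2 : ℝ) ^ load t X z) (Measure.pi fun _ => χ) := by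
  refine Integrable.of_bound
    ((measurable_of_countable fun k : ℕ => (2 : ℝ) ^ k).comp
      (measurable_load t z)).aestronglyMeasurable (2 ^ n) (ae_of_all _ fun X => ?_)
  rw [Real.norm_of_nonneg (by positivity)]
  exact pow_le_pow_right₀ one_le_two (load_le t X z)

lemma integrable_two_pow_maxLoad (χ : Measure ℝ) [IsProbabilityMeasure χ] (t : ℕ) :
    Integrable (fun X : Fin n → ℝ => (2 : ℝ) ^ maxLoad t X) (Measure.pi fun _ => χ) := by
  refine Integrable.of_bound
    ((measurable_of_countable fun k : ℕ => (2 : ℝ) ^ k).comp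
      (measurable_maxLoad t)).aestronglyMeasurable (2 ^ n) (ae_of_all _ fun X => ?_)
  rw [Real.norm_of_nonneg (by positivity)]
  exact pow_le_pow_right₀ one_le_two (maxLoad_le t X)

/-- Subtracting 1 makes empty pieces contribute nothing. Without it the sum would be of order `t`,
and the ratio `ρ₂/ρ₁` would enter the query time. -/
lemma two_pow_maxLoad_le {t : ℕ} (ht : 0 < t) (X : Fin n → ℝ) :
    (2 : ℝ) ^ maxLoad t X ≤ 1 + ∑ z ∈ Finset.range t, ((2 : ℝ) ^ load t X z - 1) := by
  obtain ⟨z, hz, h⟩ := Finset.exists_mem_eq_sup (Finset.range t) ⟨0, Finset.mem_range.2 ht⟩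
    (load t X)
  have h₀ : ∀ z ∈ Finset.range t, (0 : ℝ) ≤ (2 : ℝ) ^ load t X z - 1 := fun z _ =>
    sub_nonneg.2 (one_le_pow₀ one_le_two)
  have := Finset.single_le_sum h₀ hz
  rw [maxLoad, h]
  linarith

lemma one_add_pow_sub_one_le {p : ℝ} (hp : 0 ≤ p) (h : n * p ≤ 1) :
    (1 + p) ^ n - 1 ≤ 2 * n * p := by
  have h₀ : 0 ≤ n * p := by positivity
  have h₁ : (1 + p) ^ n ≤ Real.exp (n * p) := by
    rw [Real.exp_nat_mul]
    exact pow_le_pow_left₀ (by linarith) (by linarith [Real.add_one_le_exp p]) n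
  have h₂ := Real.abs_exp_sub_one_le (x := n * p) (by rwa [abs_of_nonneg h₀])
  rw [abs_of_nonneg h₀] at h₂
  linarith [le_abs_self (Real.exp (n * p) - 1)]

lemma integral_two_pow_maxLoad_le (χ : Measure ℝ) [IsProbabilityMeasure χ] {t : ℕ} (ht : 0 < t)
    (h : ∀ z < t, n * χ.real (bin t ⁻¹' {z}) ≤ 1) :
    ∫ X : Fin n → ℝ, (2 : ℝ) ^ maxLoad t X ∂(Measure.pi fun _ => χ) ≤ 1 + 2 * n := by
  have hi : ∀ z ∈ Finset.range t, Integrable (fun X : Fin n → ℝ => (2 : ℝ) ^ load t X z - 1)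
      (Measure.pi fun _ => χ) := fun z _ =>
    (integrable_two_pow_load χ t z).sub (integrable_const _)
  calc ∫ X : Fin n → ℝ, (2 : ℝ) ^ maxLoad t X ∂(Measure.pi fun _ => χ)
      ≤ ∫ X : Fin n → ℝ, 1 + ∑ z ∈ Finset.range t, ((2 : ℝ) ^ load t X z - 1)
          ∂(Measure.pi fun _ => χ) :=
        integral_mono (integrable_two_pow_maxLoad χ t)
          ((integrable_const _).add (integrable_finsetSum _ hi))
          fun X => two_pow_maxLoad_le ht X
    _ = 1 + ∑ z ∈ Finset.range t, ((1 + χ.real (bin t ⁻¹' {z})) ^ n - 1) := by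
        rw [integral_add (integrable_const _) (integrable_finsetSum _ hi),
          integral_finsetSum _ hi]
        congr 1
        · simp
        · refine Finset.sum_congr rfl fun z _ => ?_
          rw [integral_sub (integrable_two_pow_load χ t z) (integrable_const _),
            integral_two_pow_load]
          simp
    _ ≤ 1 + ∑ z ∈ Finset.range t, 2 * n * χ.real (bin t ⁻¹' {z}) := by
        gcongr with z hz
        exact one_add_pow_sub_one_le measureReal_nonneg (h z (Finset.mem_range.1 hz))
    -- The pieces are disjoint, so their masses sum to at most 1, whatever `t` is.
    _ ≤ 1 + 2 * n := by
        rw [← Finset.mul_sum, sum_measureReal_preimage_singleton _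
          fun z _ => measurable_bin t (measurableSet_singleton z)]
        have : χ.real (bin t ⁻¹' ↑(Finset.range t)) ≤ 1 := measureReal_le_one
        have hn : (0 : ℝ) ≤ 2 * n := by positivity
        nlinarith

/-- Two uses of `log y ≤ y - 1`: at `y = x = 2^e / n` it gives `e ≤ 2 (log n + x - 1)`, and at `y =
(e + 1) / log n` it extracts `log log n`. Linearity in `2^e` lets the exponential moment be inserted
directly. -/
lemma log_add_one_le (hn : 3 ≤ n) (e : ℕ) :
    Real.log (e + 1) ≤ Real.log (Real.log n) + 2 + 2 * (2 ^ e / n) := by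
  have hL := one_le_log_of_three_le hn
  have hn' : (0 : ℝ) < n := by positivity
  set L := Real.log n with hLn
  set x : ℝ := 2 ^ e / n with hx
  have hx0 : 0 < x := by positivity
  have h₁ : Real.log x = e * Real.log 2 - L := by
    rw [hx, Real.log_div (by positivity) hn'.ne', Real.log_pow]
  have h₂ := Real.log_le_sub_one_of_pos hx0
  have h₃ := Real.log_two_gt_d9
  have h₄ : (e : ℝ) ≤ 2 * (L + x - 1) := by
    have : (0 : ℝ) ≤ e := by positivity
    nlinarith
  have h₅ := Real.log_le_sub_one_of_pos (x := (e + 1) / L) (by positivity)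
  rw [Real.log_div (by positivity) (by positivity)] at h₅
  have h₆ : ((e : ℝ) + 1) / L ≤ 3 + 2 * x := by
    rw [div_le_iff₀ (by linarith)]
    nlinarith
  linarith

lemma integrable_pieceIndex_ops (χ : Measure ℝ) [IsProbabilityMeasure χ] {t : ℕ} (ht : 0 < t)
    (q : ℝ) :
    Integrable (fun X : Fin n → ℝ =>
      ((pieceIndex t ht (sortedArray X)).ops (sortedArray X) q : ℝ)) (Measure.pi fun _ => χ) := by
  refine Integrable.of_bound ((measurable_of_countable fun k : ℕ => (k : ℝ)).comp
    (measurable_pieceIndex_ops ht q)).aestronglyMeasurable (30 + 9 * Real.log (n + 1))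
    (ae_of_all _ fun X => ?_)
  rw [Real.norm_of_nonneg (by positivity)]
  refine (pieceIndex_ops_le ht _ q).trans ?_
  gcongr
  exact maxLoad_le t _

lemma integral_pieceIndex_ops_le (χ : Measure ℝ) [IsProbabilityMeasure χ] {t : ℕ} (ht : 0 < t)
    (hn : 3 ≤ n) (h : ∀ z < t, n * χ.real (bin t ⁻¹' {z}) ≤ 1) (q : ℝ) :
    ∫ X : Fin n → ℝ, ((pieceIndex t ht (sortedArray X)).ops (sortedArray X) q : ℝ)
      ∂(Measure.pi fun _ => χ) ≤ 9 * Real.log (Real.log n) + 102 := by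
  have hn' : (3 : ℝ) ≤ n := by exact_mod_cast hn
  calc ∫ X : Fin n → ℝ, ((pieceIndex t ht (sortedArray X)).ops (sortedArray X) q : ℝ)
        ∂(Measure.pi fun _ => χ)
      ≤ ∫ X : Fin n → ℝ, (9 * Real.log (Real.log n) + 48) + 18 / n * (2 : ℝ) ^ maxLoad t X
        ∂(Measure.pi fun _ => χ) := by
        refine integral_mono (integrable_pieceIndex_ops χ ht q)
          ((integrable_const _).add ((integrable_two_pow_maxLoad χ t).const_mul _)) fun X => ?_
        have h₁ := pieceIndex_ops_le ht (sortedArray X) q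
        rw [maxLoad_sortedArray] at h₁
        have h₂ := log_add_one_le hn (maxLoad t X)
        have h₃ : 18 / n * (2 : ℝ) ^ maxLoad t X = 18 * (2 ^ maxLoad t X / n) := by ring
        simp only [h₃]
        linarith
    _ = 9 * Real.log (Real.log n) + 48
        + 18 / n * ∫ X : Fin n → ℝ, (2 : ℝ) ^ maxLoad t X ∂(Measure.pi fun _ => χ) := by
        rw [integral_add (integrable_const _) ((integrable_two_pow_maxLoad χ t).const_mul _),
          integral_const_mul]
        simp
    _ ≤ 9 * Real.log (Real.log n) + 48 + 18 / n * (1 + 2 * n) := by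
        gcongr
        exact integral_two_pow_maxLoad_le χ ht h
    _ ≤ 9 * Real.log (Real.log n) + 102 := by
        have : 18 / (n : ℝ) * (1 + 2 * n) ≤ 54 := by
          rw [div_mul_eq_mul_div, div_le_iff₀ (by linarith)]
          linarith
        linarith

end Expectation

/-! ### Masses of pieces under a bounded density -/

section Density

lemma Icc_inter_preimage_bin_subset {t : ℕ} (ht : 0 < t) (z : ℕ) :
    bin t ⁻¹' {z} ∩ Set.Icc 0 1 ⊆ Set.Icc ((z : ℝ) / t) ((z + 1) / t) := by
  rintro x ⟨hz, h0, h1⟩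
  have ht' : (0 : ℝ) < t := by exact_mod_cast ht
  have hx : 0 ≤ x * t := by positivity
  rw [Set.mem_preimage, Set.mem_singleton_iff, bin] at hz
  constructor
  · rw [div_le_iff₀ ht', ← Nat.le_floor_iff hx]
    omega
  · rw [le_div_iff₀ ht']
    -- The floor is cut off only in the last piece, which also receives `x = 1`; there `z + 1 = t`
    -- and `x ≤ 1` is used instead.
    rcases le_total (t - 1) ⌊x * (t : ℝ)⌋₊ with h | h
    · have : ((z + 1 : ℕ) : ℝ) = t := by congr 1; omega
      push_cast at this
      rw [this]
      nlinarith
    · rw [min_eq_right h] at hz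
      rw [← hz]
      exact (Nat.lt_floor_add_one _).le

variable {χ : Measure ℝ} {f : ℝ → ℝ} {ρ₁ ρ₂ : ℝ}

lemma measureReal_preimage_bin_le (hρ : 0 ≤ ρ₂) (hf : ∀ x ∈ Set.Icc (0 : ℝ) 1, f x ≤ ρ₂)
    (hχ : χ = (volume.restrict (Set.Icc (0 : ℝ) 1)).withDensity fun x => ENNReal.ofReal (f x))
    {t : ℕ} (ht : 0 < t) (z : ℕ) : χ.real (bin t ⁻¹' {z}) ≤ ρ₂ / t := by
  have hs : MeasurableSet (bin t ⁻¹' {z}) := measurable_bin t (measurableSet_singleton z)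
  have ht' : (0 : ℝ) < t := by exact_mod_cast ht
  refine ENNReal.toReal_le_of_le_ofReal (by positivity) ?_
  rw [hχ, withDensity_apply _ hs, Measure.restrict_restrict hs]
  calc ∫⁻ x in bin t ⁻¹' {z} ∩ Set.Icc 0 1, ENNReal.ofReal (f x)
      ≤ ∫⁻ x in bin t ⁻¹' {z} ∩ Set.Icc 0 1, ENNReal.ofReal ρ₂ :=
        setLIntegral_mono' (hs.inter measurableSet_Icc)
          fun x hx => ENNReal.ofReal_le_ofReal (hf x hx.2)
    _ = ENNReal.ofReal ρ₂ * volume (bin t ⁻¹' {z} ∩ Set.Icc 0 1) := by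
        rw [setLIntegral_const]
    _ ≤ ENNReal.ofReal ρ₂ * volume (Set.Icc ((z : ℝ) / t) ((z + 1) / t)) := by
        gcongr
        exact Icc_inter_preimage_bin_subset ht z
    _ = ENNReal.ofReal (ρ₂ / t) := by
        rw [Real.volume_Icc, ← ENNReal.ofReal_mul hρ]
        congr 1
        ring

lemma lower_density_le_one [IsProbabilityMeasure χ] (hf : ∀ x ∈ Set.Icc (0 : ℝ) 1, ρ₁ ≤ f x)
    (hχ : χ = (volume.restrict (Set.Icc (0 : ℝ) 1)).withDensity fun x => ENNReal.ofReal (f x)) :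
    ρ₁ ≤ 1 := by
  have h : ENNReal.ofReal ρ₁ ≤ 1 := by
    calc ENNReal.ofReal ρ₁ = ∫⁻ _ in Set.Icc (0 : ℝ) 1, ENNReal.ofReal ρ₁ := by simp
      _ ≤ ∫⁻ x in Set.Icc (0 : ℝ) 1, ENNReal.ofReal (f x) :=
        setLIntegral_mono' measurableSet_Icc fun x hx => ENNReal.ofReal_le_ofReal (hf x hx)
      _ = χ Set.univ := by rw [hχ, withDensity_apply _ MeasurableSet.univ, Measure.restrict_univ]
      _ = 1 := measure_univ
  exact ENNReal.ofReal_le_one.1 h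

end Density

end LearnedIndex

/-! ### Choice of the constants and assembly -/

theorem theorem3 :
    ∃ C : ℝ, 0 < C ∧
      ∀ ρ₁ ρ₂ : ℝ, 0 < ρ₁ → ρ₁ ≤ ρ₂ → ∀ n : ℕ, 3 ≤ n →
        ∃ build : (Fin n → ℝ) → LearnedIndex.RMI,
          (∀ A : Fin n → ℝ, Monotone A → (∀ i, A i ∈ Set.Icc (0 : ℝ) 1) →
            (∀ q : ℝ, (build A).answer A q = LearnedIndex.rank A q) ∧
            ((build A).depth : ℝ) ≤ C * Real.log (Real.log n) ∧
            ((build A).bits : ℝ) ≤ C * ((ρ₂ / ρ₁) * n * Real.log n)) ∧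
          (∀ (χ : Measure ℝ) [IsProbabilityMeasure χ] (f : ℝ → ℝ), Measurable f →
            (∀ x ∈ Set.Icc (0 : ℝ) 1, ρ₁ ≤ f x ∧ f x ≤ ρ₂) →
            χ = (volume.restrict (Set.Icc (0 : ℝ) 1)).withDensity
              (fun x => ENNReal.ofReal (f x)) →
            ∀ q : ℝ,
              Integrable (fun X : Fin n → ℝ =>
                ((build (LearnedIndex.sortedArray X)).ops (LearnedIndex.sortedArray X) q : ℝ))
                (Measure.pi fun _ : Fin n => χ) ∧
              ∫ X : Fin n → ℝ,
                ((build (LearnedIndex.sortedArray X)).ops (LearnedIndex.sortedArray X) q : ℝ)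
                ∂(Measure.pi fun _ : Fin n => χ) ≤ C * Real.log (Real.log n)) := by
  -- As `3 > e`, `log log n ≥ c > 0` for all `n ≥ 3`; the term `1 / c` in the constant absorbs
  -- additive constants.
  set c := Real.log (Real.log 3) with hc
  have hlog3 : 1 < Real.log 3 := by
    rw [Real.lt_log_iff_exp_lt (by norm_num)]
    exact Real.exp_one_lt_three
  have hc0 : 0 < c := Real.log_pos hlog3
  refine ⟨102 * (1 + 1 / c), by positivity, fun ρ₁ ρ₂ h₁ h₁₂ n hn => ?_⟩
  have hn' : (3 : ℝ) ≤ n := by exact_mod_cast hn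
  have hL := LearnedIndex.one_le_log_of_three_le hn
  have hcn : c ≤ Real.log (Real.log n) :=
    Real.log_le_log (by linarith) (Real.log_le_log (by norm_num) hn')
  have hC : 102 * Real.log (Real.log n) + 102 ≤ 102 * (1 + 1 / c) * Real.log (Real.log n) := by
    have : 1 ≤ 1 / c * Real.log (Real.log n) := by
      rw [one_div_mul_eq_div, le_div_iff₀ hc0]
      linarith
    linarith
  have hρ : 1 ≤ ρ₂ / ρ₁ := (one_le_div h₁).2 h₁₂
  -- Large enough for `n ρ₂ / t ≤ ρ₁ ≤ 1`, yet at most `2 (ρ₂/ρ₁) n`, as the space bound requires.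
  set t := ⌈ρ₂ / ρ₁ * n⌉₊ with htdef
  have htl : ρ₂ / ρ₁ * n ≤ t := Nat.le_ceil _
  have htu : (t : ℝ) < ρ₂ / ρ₁ * n + 1 := Nat.ceil_lt_add_one (by positivity)
  have hnt' : (n : ℝ) ≤ t := by nlinarith
  have hnt : n ≤ t := by exact_mod_cast hnt'
  have ht : 0 < t := by omega
  refine ⟨LearnedIndex.pieceIndex t ht, fun A hA _ => ⟨fun q =>
    LearnedIndex.pieceIndex_answer ht hA q, ?_, ?_⟩, fun χ _ f _ hf hχ q =>
    ⟨LearnedIndex.integrable_pieceIndex_ops χ ht q, ?_⟩⟩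
  · rw [LearnedIndex.pieceIndex_depth]
    push_cast
    linarith
  · have hb : ((LearnedIndex.pieceIndex t ht A).bits : ℝ) ≤ 25 * t + t * Nat.size n := by
      exact_mod_cast LearnedIndex.pieceIndex_bits_le ht (by omega) hnt A
    have hs := LearnedIndex.size_le_three_mul_log hn
    calc ((LearnedIndex.pieceIndex t ht A).bits : ℝ) ≤ t * (25 + Nat.size n) := by linarith
      _ ≤ (2 * (ρ₂ / ρ₁ * n)) * (28 * Real.log n) := by
          gcongr
          · nlinarith
          · linarith
      _ = 56 * (ρ₂ / ρ₁ * n * Real.log n) := by ring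
      _ ≤ 102 * (1 + 1 / c) * (ρ₂ / ρ₁ * n * Real.log n) := by
          have : 0 ≤ 1 / c := by positivity
          gcongr
          linarith
  · refine (LearnedIndex.integral_pieceIndex_ops_le χ ht hn (fun z _ => ?_) q).trans (by linarith)
    have hp := LearnedIndex.measureReal_preimage_bin_le (by linarith) (fun x hx => (hf x hx).2)
      hχ ht z
    have hρ₁ := LearnedIndex.lower_density_le_one (fun x hx => (hf x hx).1) hχ
    have ht' : (0 : ℝ) < t := by exact_mod_cast ht
    calc n * χ.real (LearnedIndex.bin t ⁻¹' {z}) ≤ n * (ρ₂ / t) := by gcongr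
      _ = ρ₁ * (ρ₂ / ρ₁ * n) / t := by field_simp
      _ ≤ ρ₁ * t / t := by gcongr
      _ = ρ₁ := by field_simp
      _ ≤ 1 := hρ₁
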